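/- Let $K$ be a field, $n\ge 0$, and $S=K[x_1,\dots,x_n]$ with its $\mathbb Z^n$-grading ($\deg x_i=\epsilon_i$, the $i$-th unit vector). For $F\subseteq[n]=\{1,\dots,n\}$ put $x_F=\prod_{j\in F}x_j$ and $P_F=(x_i : i\in F)$, and identify $F$ with its $0/1$-vector in $\mathbb Z^n$. For a graded module $M$, the module $M(-G)$ has components $M(-G)_a=M_{a-G}$, and $\cong$ denotes isomorphism of graded $S$-modules. A squarefree monomial ideal is an ideal generated by a (possibly empty) set of monomials $x_F$, $F\subseteq[n]$; it can be written uniquely as $I=I_\Delta=(x_F : F\notin\Delta)$ for a simplicial complex $\Delta$ on $[n]$ (a possibly empty family of subsets of $[n]$ closed under taking subsets), and we put $\tilde I=I_{\Delta^\vee}$, where $\Delta^\vee=\{F : [n]\setminus F\notin\Delta\}$. A squarefree $S$-module is a finitely generated $\mathbb N^n$-graded $S$-module $M$ such that $x_i\colon M_a\to M_{a+\epsilon_i}$ is bijective whenever $a\in\mathbb N^n$ and $a_i\neq 0$. Its Alexander dual $M^\vee$ is the squarefree $S$-module, unique up to graded isomorphism, with $(M^\vee)_F=\operatorname{Hom}_K(M_{[n]\setminus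 F},K)$ for all $F\subseteq[n]$ and such that, for $i\notin F$, the map $x_i\colon (M^\vee)_F\to(M^\vee)_{F\cup\{i\}}$ is the transpose of $x_i\colon M_{[n]\setminus(F\cup\{i\})}\to M_{[n]\setminus F}$. For ideals $I\subseteq J$ of $S$, a multigraded prime filtration of $J/I$ with data $(F_i,G_i)_{1\le i\le r}$, where $F_i,G_i\subseteq[n]$, is a chain of graded (that is, monomial) ideals $I=I_0\subseteq I_1\subseteq\dots\subseteq I_r=J$ with $I_i/I_{i-1}\cong S/P_{F_i}(-G_i)$ for $i=1,\dots,r$. Let $I\subseteq J$ be squarefree monomial ideals of $S$. Then $\tilde J\subseteq\tilde I$, the modules $J/I$ and $\tilde I/\tilde J$ are squarefree, and $\tilde I/\tilde J$ is the Alexander dual $(J/I)^\vee$. Moreover, for every $r\ge 0$, all ideals $I_0,\dots,I_r$ of $S$ and all subsets $F_1,\dots,F_r,G_1,\dots,G_r$ of $[n]$, the following are equivalent: (a) $I=I_0\subseteq I_1\subseteq\dots\subseteq I_r=J$ is a multigraded prime filtration of $J/I$ with $I_i/I_{i-1}\cong S/P_{F_i}(-G_i)$ for $i=1,\dots,r$;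 (b) $I_0,\dots,I_r$ are squarefree monomial ideals, and $\tilde J=\tilde I_r\subseteq\tilde I_{r-1}\subseteq\dots\subseteq\tilde I_0=\tilde I$ is a multigraded prime filtration of $\tilde I/\tilde J=(J/I)^\vee$ with $\tilde I_{i-1}/\tilde I_i\cong S/P_{G_i}(-F_i)$ for $i=1,\dots,r$. -/

import Mathlib

open MvPolynomial

noncomputable section

namespace SqMod

variable {K : Type*} [Field K] {n : ℕ}

/-! ### The polynomial ring and its grading by exponent vectors -/

/-- The polynomial ring `S = K[x_1, …, x_n]`. -/
abbrev Poly (K : Type*) [Field K] (n : ℕ) : Type _ := MvPolynomial (Fin n) K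

/-- The multidegree `ε_i ∈ ℤ^n` of the variable `x_i`. -/
def eps {n : ℕ} (i : Fin n) : Fin n → ℤ := Pi.single i 1

/-- The squarefree vector in `{0,1}^n ⊆ ℤ^n` with support `F`. -/
def vec {n : ℕ} (F : Finset (Fin n)) : Fin n → ℤ := fun j => if j ∈ F then 1 else 0

/-- The component `S_a` of the polynomial ring (zero unless `a ≥ 0`). -/
def polyGrading (K : Type*) [Field K] (n : ℕ) (a : Fin n → ℤ) : Submodule K (Poly K n) :=
  weightedHomogeneousSubmodule K eps a

/-- The squarefree monomial `x_F = ∏_{j ∈ F} x_j`. -/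
def sqMonomial (K : Type*) [Field K] {n : ℕ} (F : Finset (Fin n)) : Poly K n := ∏ j ∈ F, X j

/-- The monomial prime ideal `P_F = (x_i : i ∈ F)`. -/
def monomialPrime (K : Type*) [Field K] {n : ℕ} (F : Finset (Fin n)) : Ideal (Poly K n) :=
  Ideal.span ((fun i => (X i : Poly K n)) '' (F : Set (Fin n)))

/-- An ideal is graded for the multigrading when it contains all the homogeneous components of
its elements (that is, when it is a monomial ideal). -/
def IsGradedIdeal (I : Ideal (Poly K n)) : Prop :=
  ∀ f ∈ I, ∀ a : Fin n → ℤ, weightedHomogeneousComponent eps a f ∈ I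

/-- `I` is generated by squarefree monomials (the zero ideal and `S` are allowed). -/
def IsSquarefreeMonomialIdeal (I : Ideal (Poly K n)) : Prop :=
  ∃ A : Set (Finset (Fin n)), I = Ideal.span (sqMonomial K '' A)

/-! ### Simplicial complexes, Stanley–Reisner ideals, Alexander duality of ideals

A simplicial complex on `[n]` is a family of subsets of `[n]` closed under passing to subsets,
that is, a `LowerSet (Finset (Fin n))`. The family may be empty, and vertices need not be faces. -/

/-- The Stanley–Reisner ideal `I_Δ = (x_F : F ∉ Δ)`. -/
def srIdeal (K : Type*) [Field K] {n : ℕ} (Δ : LowerSet (Finset (Fin n))) : Ideal (Poly K n) :=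
  Ideal.span (sqMonomial K '' {F | F ∉ Δ})

/-- The Alexander dual complex `Δ^∨ = {F : F^c ∉ Δ}`. -/
def dualComplex {n : ℕ} (Δ : LowerSet (Finset (Fin n))) : LowerSet (Finset (Fin n)) where
  carrier := {F | Fᶜ ∉ Δ}
  lower' := fun _ _ hGF hF hG => hF (Δ.lower (compl_le_compl hGF) hG)

/-- The simplicial complex `{F : x_F ∉ I}` of an ideal. For a squarefree monomial ideal it is the
unique `Δ` with `I = I_Δ`; see `srIdeal_complexOf` and `complexOf_srIdeal`. -/
def complexOf (I : Ideal (Poly K n)) : LowerSet (Finset (Fin n)) where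
  carrier := {F | sqMonomial K F ∉ I}
  lower' := fun _ _ hGF hF hG =>
    hF (Ideal.mem_of_dvd I (Finset.prod_dvd_prod_of_subset _ _ _ hGF) hG)

theorem mem_complexOf {I : Ideal (Poly K n)} {F : Finset (Fin n)} :
    F ∈ complexOf I ↔ sqMonomial K F ∉ I := Iff.rfl

theorem srIdeal_complexOf {I : Ideal (Poly K n)} (hI : IsSquarefreeMonomialIdeal I) :
    srIdeal K (complexOf I) = I := by
  obtain ⟨A, rfl⟩ := hI
  apply le_antisymm
  · refine Ideal.span_le.2 ?_
    rintro _ ⟨F, hF, rfl⟩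
    exact not_not.1 hF
  · refine Ideal.span_mono (Set.image_mono fun F hF => ?_)
    exact not_not.2 (Ideal.subset_span ⟨F, hF, rfl⟩)

theorem complexOf_srIdeal (Δ : LowerSet (Finset (Fin n))) : complexOf (srIdeal K Δ) = Δ := by
  ext F
  refine not_iff_comm.1 ⟨fun hF => Ideal.subset_span ⟨F, hF, rfl⟩, fun hmem hF => ?_⟩
  have hle : srIdeal K Δ ≤ RingHom.ker (eval fun j => if j ∈ F then (1 : K) else 0) := by
    refine Ideal.span_le.2 ?_
    rintro _ ⟨G, hG, rfl⟩
    have hGF : ¬ G ⊆ F := fun h => hG (Δ.lower h hF)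
    obtain ⟨j, hjG, hjF⟩ := Finset.not_subset.1 hGF
    simp only [SetLike.mem_coe, RingHom.mem_ker, sqMonomial, map_prod, eval_X]
    exact Finset.prod_eq_zero hjG (by simp [hjF])
  have h0 := hle hmem
  simp only [RingHom.mem_ker, sqMonomial, map_prod, eval_X] at h0
  rw [Finset.prod_congr rfl (fun j hj => if_pos hj)] at h0
  simp at h0

/-- The dual ideal `Ĩ = I_{Δ^∨}`, where `I = I_Δ`. -/
def dualIdeal (I : Ideal (Poly K n)) : Ideal (Poly K n) := srIdeal K (dualComplex (complexOf I))

/-! ### Graded modules -/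

/-- The graded module `J/I`, for ideals `I ⊆ J`. -/
abbrev SubQuot (J I : Ideal (Poly K n)) : Type _ := ↥J ⧸ Submodule.submoduleOf I J

/-- The component `(J/I)_a`: the classes of the elements of `J` that lie in `S_a`. -/
def subQuotGrading (J I : Ideal (Poly K n)) (a : Fin n → ℤ) : Submodule K (SubQuot J I) :=
  ((polyGrading K n a).comap ((Submodule.subtype J).restrictScalars K)).map
    ((Submodule.mkQ (Submodule.submoduleOf I J)).restrictScalars K)

/-- The component `(S/P)_a`. -/
def quotGrading (P : Ideal (Poly K n)) (a : Fin n → ℤ) : Submodule K (Poly K n ⧸ P) :=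
  (polyGrading K n a).map (Ideal.Quotient.mkₐ K P).toLinearMap

/-- The grading of the shifted module `M(-g)`, with `M(-g)_a = M_{a-g}`. -/
def shiftNeg {M : Type*} [AddCommGroup M] [Module K M]
    (gr : (Fin n → ℤ) → Submodule K M) (g a : Fin n → ℤ) : Submodule K M := gr (a - g)

/-- Two graded `S`-modules are isomorphic: there is an `S`-linear isomorphism preserving
degrees. -/
def GradedIso {M N : Type*} [AddCommGroup M] [Module K M] [Module (Poly K n) M]
    [AddCommGroup N] [Module K N] [Module (Poly K n) N]
    (gr : (Fin n → ℤ) → Submodule K M) (gr' : (Fin n → ℤ) → Submodule K N) : Prop :=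
  ∃ e : M ≃ₗ[Poly K n] N, ∀ (a : Fin n → ℤ) (m : M), m ∈ gr a ↔ e m ∈ gr' a

/-- `I = L 0 ⊆ L 1 ⊆ ⋯ ⊆ L r = J` is a multigraded prime filtration of `J/I` whose `i`-th
factor is isomorphic to `S/P_{F i}(-G i)` as a graded module. -/
structure IsPrimeFiltration (I J : Ideal (Poly K n)) (r : ℕ) (L : Fin (r + 1) → Ideal (Poly K n))
    (F G : Fin r → Finset (Fin n)) : Prop where
  bot : L 0 = I
  top : L (Fin.last r) = J
  graded : ∀ i, IsGradedIdeal (L i)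
  le : ∀ i : Fin r, L i.castSucc ≤ L i.succ
  factor : ∀ i : Fin r,
    GradedIso (subQuotGrading (L i.succ) (L i.castSucc))
      (shiftNeg (quotGrading (monomialPrime K (F i))) (vec (G i)))

/-! ### Squarefree modules and their Alexander duals -/

/-- A squarefree `S`-module: a finitely generated `ℕ^n`-graded module `M` such that
multiplication by `x_i` is a bijection `M_a → M_{a+ε_i}` for all `a ∈ ℕ^n`, `i ∈ supp a`. An
`ℕ^n`-grading is a `ℤ^n`-grading concentrated in degrees `a ≥ 0`. -/
structure IsSquarefreeModule {M : Type*} [AddCommGroup M] [Module K M] [Module (Poly K n) M]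
    [IsScalarTower K (Poly K n) M] (gr : (Fin n → ℤ) → Submodule K M) : Prop where
  finite : Module.Finite (Poly K n) M
  internal : DirectSum.IsInternal gr
  nonneg : ∀ a, ¬ 0 ≤ a → gr a = ⊥
  smul_mem : ∀ (i : Fin n) (a : Fin n → ℤ), ∀ m ∈ gr a, (X i : Poly K n) • m ∈ gr (a + eps i)
  bijOn : ∀ (i : Fin n) (a : Fin n → ℤ), 0 ≤ a → a i ≠ 0 →
    Set.BijOn (fun m : M => (X i : Poly K n) • m) (gr a) (gr (a + eps i))

/-- The squarefree module `D` is the Alexander dual `M^∨` of the squarefree module `M`: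
`D_F = Hom_K(M_{[n] ∖ F}, K)` for all `F ⊆ [n]`, and for `i ∉ F` the map
`x_i : D_F → D_{F ∪ {i}}` is the transpose of `x_i : M_{[n] ∖ (F ∪ {i})} → M_{[n] ∖ F}`.
In the last clause `p'` and `p` name the elements `x_i m'` and `x_i m` of these components. A
squarefree module is determined, up to graded isomorphism, by its squarefree components and the
multiplication maps between them. -/
def IsAlexanderDual {M D : Type*} [AddCommGroup M] [Module K M] [Module (Poly K n) M]
    [IsScalarTower K (Poly K n) M] [AddCommGroup D] [Module K D] [Module (Poly K n) D]
    [IsScalarTower K (Poly K n) D]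
    (gr : (Fin n → ℤ) → Submodule K M) (gr' : (Fin n → ℤ) → Submodule K D) : Prop :=
  IsSquarefreeModule gr ∧ IsSquarefreeModule gr' ∧
  ∃ d : ∀ F : Finset (Fin n), gr' (vec F) ≃ₗ[K] Module.Dual K (gr (vec Fᶜ)),
    ∀ (F : Finset (Fin n)) (i : Fin n), i ∉ F →
      ∀ (m' : gr' (vec F)) (p' : gr' (vec (insert i F)))
        (m : gr (vec (insert i F)ᶜ)) (p : gr (vec Fᶜ)),
        (p' : D) = (X i : Poly K n) • (m' : D) → (p : M) = (X i : Poly K n) • (m : M) →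
        d (insert i F) p' m = d F m' p

end SqMod

end

/-! Everything is decided by monomials. For graded ideals `I ⊆ J`, each component of `J/I` has
dimension at most one and is nonzero in degree `d` exactly when `x^d ∈ J ∖ I`. Hence `J/I ≅
S/P_F(-G)` holds precisely when the exponents of `J ∖ I` form the cell `{d ≥ G : d_i = G_i for i ∈
F}` (`gradedIso_iff`).

If `I` and `J` are squarefree, membership of `x^d` depends only on the support of `d`. This forces
`F ∩ G = ∅`, and the cell becomes `G ⊆ supp d`, `F ∩ supp d = ∅`. Since `x_A ∈ Ĩ` iff `x_{A^c} ∉ I`,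
complementation of supports carries `J ∖ I` to `Ĩ ∖ J̃` and exchanges the roles of `F` and `G`
(`gradedIso_dualIdeal`). The same complementation makes the product of coefficients a perfect
pairing, which gives the Alexander dual.

In a prime filtration starting at a squarefree ideal, squarefreeness propagates upwards through the
cells (`IsPrimeFiltration.isSquarefreeMonomialIdeal`), so every factor can be dualized. The converse
is the same duality applied again, because `Ĩ` dualizes back to `I`. -/

noncomputable section

namespace SqMod

variable {K : Type*} [Field K] {n : ℕ}

/-! ### Exponent vectors -/

/-- The multidegree in `ℤ^n` of the monomial with exponent `d`. -/
def toVec (d : Fin n →₀ ℕ) : Fin n → ℤ := fun i => d i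

/-- The exponent of the squarefree monomial `x_F`. -/
def ind (F : Finset (Fin n)) : Fin n →₀ ℕ := Finsupp.equivFunOnFinite.symm fun j => if j ∈ F then 1 else 0

theorem ind_apply (F : Finset (Fin n)) (j : Fin n) : ind F j = if j ∈ F then 1 else 0 := rfl

theorem toVec_ind (F : Finset (Fin n)) : toVec (ind F) = vec F := by
  funext j
  simp [toVec, vec, ind_apply]

theorem support_ind (F : Finset (Fin n)) : (ind F).support = F := by
  ext j
  simp [ind_apply]

theorem ind_le_iff {F : Finset (Fin n)} {d : Fin n →₀ ℕ} : ind F ≤ d ↔ F ⊆ d.support := by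
  rw [Finsupp.le_def]
  refine forall_congr' fun j => ?_
  by_cases h : j ∈ F <;> simp [ind_apply, h, Nat.one_le_iff_ne_zero]

theorem ind_insert {F : Finset (Fin n)} {i : Fin n} (hi : i ∉ F) :
    ind (insert i F) = Finsupp.single i 1 + ind F := by
  ext j
  by_cases h : j = i
  · subst h
    simp [ind_apply, hi]
  · simp [ind_apply, h]

theorem toVec_injective : Function.Injective (toVec (n := n)) := fun d e h => by
  ext i
  exact Int.natCast_inj.1 (congrFun h i)

theorem toVec_add (d e : Fin n →₀ ℕ) : toVec (d + e) = toVec d + toVec e := by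
  funext i
  simp [toVec]

theorem toVec_single (i : Fin n) : toVec (Finsupp.single i 1) = eps i := by
  funext j
  by_cases h : j = i
  · subst h
    simp [toVec, eps]
  · simp [toVec, eps, h]

theorem exists_toVec_eq {a : Fin n → ℤ} (ha : 0 ≤ a) : ∃ d : Fin n →₀ ℕ, toVec d = a :=
  ⟨Finsupp.equivFunOnFinite.symm fun i => (a i).toNat, funext fun i => Int.toNat_of_nonneg (ha i)⟩

theorem toVec_nonneg (d : Fin n →₀ ℕ) : 0 ≤ toVec d := fun _ => Int.natCast_nonneg _

theorem weight_eps (d : Fin n →₀ ℕ) : Finsupp.weight (eps (n := n)) d = toVec d := by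
  funext j
  rw [Finsupp.weight_apply, Finsupp.sum_fintype _ _ (by simp)]
  simp [eps, toVec, Finset.sum_apply, Pi.single_apply]

/-! ### Graded ideals and their monomials -/

theorem sqMonomial_eq (F : Finset (Fin n)) : sqMonomial K F = monomial (ind F) 1 := by
  induction F using Finset.induction_on with
  | empty =>
    have : ind (∅ : Finset (Fin n)) = 0 := by ext; simp [ind_apply]
    simp [sqMonomial, this]
  | insert i F hi ih =>
    rw [ind_insert hi, sqMonomial, Finset.prod_insert hi, ← sqMonomial, ih, X, monomial_mul, one_mul]

theorem mem_polyGrading {a : Fin n → ℤ} {f : Poly K n} :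
    f ∈ polyGrading K n a ↔ ∀ d, coeff d f ≠ 0 → toVec d = a := by
  simp only [polyGrading, mem_weightedHomogeneousSubmodule, IsWeightedHomogeneous, weight_eps]

theorem mem_polyGrading_toVec {d : Fin n →₀ ℕ} {f : Poly K n} :
    f ∈ polyGrading K n (toVec d) ↔ f = monomial d (coeff d f) := by
  rw [mem_polyGrading]
  constructor
  · intro h
    ext e
    rw [coeff_monomial]
    split_ifs with hde
    · rw [hde]
    · by_contra h0
      exact hde (toVec_injective (h e h0)).symm
  · intro h e he
    rw [h, coeff_monomial] at he
    split_ifs at he with hde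
    · rw [hde]
    · exact absurd rfl he

theorem monomial_mem_polyGrading (d : Fin n →₀ ℕ) (c : K) :
    monomial d c ∈ polyGrading K n (toVec d) := by
  rw [mem_polyGrading_toVec, coeff_monomial, if_pos rfl]

theorem polyGrading_eq_bot {a : Fin n → ℤ} (ha : ¬ 0 ≤ a) : polyGrading K n a = ⊥ := by
  rw [eq_bot_iff]
  intro f hf
  rw [mem_polyGrading] at hf
  rw [Submodule.mem_bot]
  ext d
  by_contra h
  exact ha (hf d h ▸ toVec_nonneg d)

theorem monomial_mem {I : Ideal (Poly K n)} {d : Fin n →₀ ℕ} (h : monomial d 1 ∈ I) (c : K) :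
    monomial d c ∈ I := by
  have := I.mul_mem_left (C c) h
  rwa [C_mul_monomial, mul_one] at this

theorem monomial_one_mem {I : Ideal (Poly K n)} {d : Fin n →₀ ℕ} {c : K} (hc : c ≠ 0)
    (h : monomial d c ∈ I) : monomial d 1 ∈ I := by
  have := I.mul_mem_left (C c⁻¹) h
  rwa [C_mul_monomial, inv_mul_cancel₀ hc] at this

theorem monomial_mem_of_le {I : Ideal (Poly K n)} {d e : Fin n →₀ ℕ} (hde : d ≤ e)
    (h : monomial d 1 ∈ I) : monomial e 1 ∈ I := by
  have := I.mul_mem_left (monomial (e - d) 1) h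
  rwa [monomial_mul, tsub_add_cancel_of_le hde, one_mul] at this

theorem mem_of_forall_monomial {I : Ideal (Poly K n)} {f : Poly K n}
    (h : ∀ d, coeff d f ≠ 0 → monomial d 1 ∈ I) : f ∈ I := by
  rw [f.as_sum]
  exact I.sum_mem fun d hd => monomial_mem (h d (mem_support_iff.1 hd)) _

theorem weightedHomogeneousComponent_toVec (d : Fin n →₀ ℕ) (f : Poly K n) :
    weightedHomogeneousComponent eps (toVec d) f = monomial d (coeff d f) := by
  classical
  ext e
  rw [coeff_weightedHomogeneousComponent, coeff_monomial, weight_eps]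
  by_cases h : d = e
  · simp [h]
  · rw [if_neg h, if_neg fun h' => h (toVec_injective h').symm]

/-- Distinct exponents have distinct multidegrees, so a homogeneous component of a polynomial is a
single term or zero. -/
theorem isGradedIdeal_iff {I : Ideal (Poly K n)} :
    IsGradedIdeal I ↔ ∀ f ∈ I, ∀ d, coeff d f ≠ 0 → monomial d 1 ∈ I := by
  classical
  constructor
  · intro h f hf d hd
    have := h f hf (toVec d)
    rw [weightedHomogeneousComponent_toVec] at this
    exact monomial_one_mem hd this
  · intro h f hf a
    refine mem_of_forall_monomial fun d hd => h f hf d fun h0 => hd ?_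
    rw [coeff_weightedHomogeneousComponent, h0, ite_self]

theorem IsGradedIdeal.ext {I J : Ideal (Poly K n)} (hI : IsGradedIdeal I) (hJ : IsGradedIdeal J)
    (h : ∀ d, monomial d 1 ∈ I ↔ monomial d 1 ∈ J) : I = J := by
  rw [isGradedIdeal_iff] at hI hJ
  exact le_antisymm (fun f hf => mem_of_forall_monomial fun d hd => (h d).1 (hI f hf d hd))
    (fun f hf => mem_of_forall_monomial fun d hd => (h d).2 (hJ f hf d hd))

theorem IsGradedIdeal.le {I J : Ideal (Poly K n)} (hI : IsGradedIdeal I)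
    (h : ∀ d, monomial d 1 ∈ I → monomial d 1 ∈ J) : I ≤ J := by
  rw [isGradedIdeal_iff] at hI
  exact fun f hf => mem_of_forall_monomial fun d hd => h d (hI f hf d hd)

/-! ### Squarefree monomial ideals -/

theorem IsSquarefreeMonomialIdeal.isGradedIdeal {I : Ideal (Poly K n)}
    (hI : IsSquarefreeMonomialIdeal I) : IsGradedIdeal I := by
  classical
  obtain ⟨A, rfl⟩ := hI
  rw [isGradedIdeal_iff]
  have : sqMonomial K '' A = (fun s => monomial s (1 : K)) '' (ind '' A) := by
    rw [Set.image_image]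
    exact Set.image_congr fun F _ => sqMonomial_eq F
  intro f hf d hd
  rw [this, mem_ideal_span_monomial_image] at hf ⊢
  intro e he
  rw [support_monomial, if_neg one_ne_zero, Finset.mem_singleton] at he
  subst he
  exact hf e (mem_support_iff.2 hd)

theorem IsSquarefreeMonomialIdeal.monomial_mem_iff {I : Ideal (Poly K n)}
    (hI : IsSquarefreeMonomialIdeal I) {d : Fin n →₀ ℕ} :
    monomial d 1 ∈ I ↔ sqMonomial K d.support ∈ I := by
  classical
  constructor
  · obtain ⟨A, rfl⟩ := hI
    have : sqMonomial K '' A = (fun s => monomial s (1 : K)) '' (ind '' A) := by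
      rw [Set.image_image]
      exact Set.image_congr fun F _ => sqMonomial_eq F
    intro h
    rw [this, mem_ideal_span_monomial_image, support_monomial, if_neg one_ne_zero] at h
    obtain ⟨_, ⟨F, hF, rfl⟩, hle⟩ := h d (Finset.mem_singleton_self d)
    rw [sqMonomial_eq]
    refine monomial_mem_of_le (d := ind F) ?_ ?_
    · rw [ind_le_iff, support_ind]
      exact ind_le_iff.1 hle
    · rw [← sqMonomial_eq]
      exact Ideal.subset_span ⟨F, hF, rfl⟩
  · rw [sqMonomial_eq]
    exact monomial_mem_of_le (ind_le_iff.2 subset_rfl)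

theorem isSquarefreeMonomialIdeal_of_forall {I : Ideal (Poly K n)} (hI : IsGradedIdeal I)
    (h : ∀ d, monomial d 1 ∈ I → sqMonomial K d.support ∈ I) : IsSquarefreeMonomialIdeal I := by
  refine ⟨{F | sqMonomial K F ∈ I}, le_antisymm (hI.le fun d hd => ?_) (Ideal.span_le.2 ?_)⟩
  · refine monomial_mem_of_le (d := ind d.support) (ind_le_iff.2 subset_rfl) ?_
    rw [← sqMonomial_eq]
    exact Ideal.subset_span ⟨_, h d hd, rfl⟩
  · rintro _ ⟨F, hF, rfl⟩
    exact hF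

/-- It suffices to lower one exponent `≥ 2` at a time. -/
theorem isSquarefreeMonomialIdeal_of_lower {I : Ideal (Poly K n)} (hI : IsGradedIdeal I)
    (h : ∀ d i, d i ≠ 0 → monomial (Finsupp.single i 1 + d) 1 ∈ I → monomial d 1 ∈ I) :
    IsSquarefreeMonomialIdeal I := by
  refine isSquarefreeMonomialIdeal_of_forall hI fun d hd => ?_
  induction d using WellFoundedLT.induction with
  | ind d ih =>
    by_cases hsq : ∃ i, 2 ≤ d i
    · obtain ⟨i, hi⟩ := hsq
      obtain ⟨e, rfl⟩ : ∃ e, d = Finsupp.single i 1 + e :=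
        ⟨d - Finsupp.single i 1, (add_tsub_cancel_of_le (by simp; omega)).symm⟩
      have hei : e i ≠ 0 := by
        simp only [Finsupp.add_apply, Finsupp.single_eq_same] at hi
        omega
      have hs : (Finsupp.single i 1 + e).support = e.support := by
        ext j
        by_cases hj : j = i
        · subst hj
          simp [hei]
        · simp [hj]
      rw [hs]
      refine ih e (lt_of_le_of_ne le_add_self fun h0 => ?_) (h e i hei hd)
      have := DFunLike.congr_fun h0 i
      simp at this
    -- No exponent is at least 2, so `x^d` is already squarefree.
    · have : d = ind d.support := by
        ext j
        have : ¬ 2 ≤ d j := fun hj => hsq ⟨j, hj⟩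
        rw [ind_apply]
        split_ifs with hj
        · rw [Finsupp.mem_support_iff] at hj
          omega
        · exact Finsupp.notMem_support_iff.1 hj
      rwa [sqMonomial_eq, ← this]

theorem isSquarefreeMonomialIdeal_dualIdeal (I : Ideal (Poly K n)) :
    IsSquarefreeMonomialIdeal (dualIdeal I) := ⟨_, rfl⟩

theorem sqMonomial_mem_dualIdeal {I : Ideal (Poly K n)} {F : Finset (Fin n)} :
    sqMonomial K F ∈ dualIdeal I ↔ sqMonomial K Fᶜ ∉ I := by
  rw [← not_iff_not, ← mem_complexOf, dualIdeal, complexOf_srIdeal]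
  rfl

theorem IsSquarefreeMonomialIdeal.ext {I J : Ideal (Poly K n)} (hI : IsSquarefreeMonomialIdeal I)
    (hJ : IsSquarefreeMonomialIdeal J) (h : ∀ F, sqMonomial K F ∈ I ↔ sqMonomial K F ∈ J) :
    I = J :=
  hI.isGradedIdeal.ext hJ.isGradedIdeal fun d => by
    rw [hI.monomial_mem_iff, hJ.monomial_mem_iff, h]

theorem dualIdeal_dualIdeal {I : Ideal (Poly K n)} (hI : IsSquarefreeMonomialIdeal I) :
    dualIdeal (dualIdeal I) = I :=
  (isSquarefreeMonomialIdeal_dualIdeal _).ext hI fun F => by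
    rw [sqMonomial_mem_dualIdeal, sqMonomial_mem_dualIdeal, compl_compl, not_not]

theorem dualIdeal_anti {I J : Ideal (Poly K n)} (h : I ≤ J) : dualIdeal J ≤ dualIdeal I := by
  refine (isSquarefreeMonomialIdeal_dualIdeal J).isGradedIdeal.le fun d => ?_
  rw [(isSquarefreeMonomialIdeal_dualIdeal _).monomial_mem_iff,
    (isSquarefreeMonomialIdeal_dualIdeal _).monomial_mem_iff, sqMonomial_mem_dualIdeal,
    sqMonomial_mem_dualIdeal]
  exact fun hd hI => hd (h hI)

/-! ### The homogeneous components of `J/I` -/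

/-- The class in `J/I` of an element of `J`. -/
def SubQuot.mk {J : Ideal (Poly K n)} (I : Ideal (Poly K n)) (f : Poly K n) (hf : f ∈ J) :
    SubQuot J I := Submodule.Quotient.mk ⟨f, hf⟩

theorem SubQuot.exists_mk {I J : Ideal (Poly K n)} (m : SubQuot J I) :
    ∃ f hf, m = SubQuot.mk I f hf := by
  obtain ⟨⟨f, hf⟩, rfl⟩ := Submodule.Quotient.mk_surjective _ m
  exact ⟨f, hf, rfl⟩

theorem SubQuot.mk_eq_mk {I J : Ideal (Poly K n)} {f g : Poly K n} {hf : f ∈ J} {hg : g ∈ J} :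
    SubQuot.mk I f hf = SubQuot.mk I g hg ↔ f - g ∈ I :=
  Submodule.Quotient.eq _

theorem SubQuot.mk_eq_zero {I J : Ideal (Poly K n)} {f : Poly K n} {hf : f ∈ J} :
    SubQuot.mk I f hf = 0 ↔ f ∈ I :=
  Submodule.Quotient.mk_eq_zero _

theorem SubQuot.smul_mk {I J : Ideal (Poly K n)} (g : Poly K n) {f : Poly K n} (hf : f ∈ J) :
    g • SubQuot.mk I f hf = SubQuot.mk I (g * f) (J.mul_mem_left g hf) := rfl

theorem mem_subQuotGrading {I J : Ideal (Poly K n)} {a : Fin n → ℤ} {m : SubQuot J I} :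
    m ∈ subQuotGrading J I a ↔ ∃ f, f ∈ polyGrading K n a ∧ ∃ hf : f ∈ J, SubQuot.mk I f hf = m := by
  constructor
  · rintro ⟨⟨f, hf⟩, h, rfl⟩
    exact ⟨f, h, hf, rfl⟩
  · rintro ⟨f, h, hf, rfl⟩
    exact ⟨⟨f, hf⟩, h, rfl⟩

theorem mem_subQuotGrading_toVec {I J : Ideal (Poly K n)} {d : Fin n →₀ ℕ} {m : SubQuot J I} :
    m ∈ subQuotGrading J I (toVec d) ↔
      ∃ c, ∃ hf : monomial d c ∈ J, SubQuot.mk I (monomial d c) hf = m := by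
  rw [mem_subQuotGrading]
  constructor
  · rintro ⟨f, h, hf, rfl⟩
    rw [mem_polyGrading_toVec] at h
    exact ⟨coeff d f, h ▸ hf, by rw [SubQuot.mk_eq_mk, ← h, sub_self]; exact I.zero_mem⟩
  · rintro ⟨c, hf, rfl⟩
    exact ⟨_, monomial_mem_polyGrading d c, hf, rfl⟩

theorem subQuotGrading_eq_bot_of_not_nonneg (J I : Ideal (Poly K n)) {a : Fin n → ℤ} (ha : ¬ 0 ≤ a) :
    subQuotGrading J I a = ⊥ := by
  rw [eq_bot_iff]
  intro m hm
  obtain ⟨f, h, hf, rfl⟩ := mem_subQuotGrading.1 hm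
  rw [polyGrading_eq_bot ha, Submodule.mem_bot] at h
  exact SubQuot.mk_eq_zero.2 (h ▸ I.zero_mem)

theorem subQuotGrading_toVec_ne_bot {I J : Ideal (Poly K n)} {d : Fin n →₀ ℕ} :
    subQuotGrading J I (toVec d) ≠ ⊥ ↔ monomial d 1 ∈ J ∧ monomial d 1 ∉ I := by
  rw [Submodule.ne_bot_iff]
  constructor
  · rintro ⟨m, hm, h0⟩
    obtain ⟨c, hc, rfl⟩ := mem_subQuotGrading_toVec.1 hm
    rw [Ne, SubQuot.mk_eq_zero] at h0
    have hc0 : c ≠ 0 := by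
      rintro rfl
      exact h0 (by simp)
    exact ⟨monomial_one_mem hc0 hc, fun h => h0 (monomial_mem h c)⟩
  · rintro ⟨hJ, hI⟩
    exact ⟨_, mem_subQuotGrading_toVec.2 ⟨1, hJ, rfl⟩, fun h => hI (SubQuot.mk_eq_zero.1 h)⟩

open Classical in
/-- The coefficient of the class of `x^d` in an element of `J/I`; zero if `x^d ∈ I`. -/
def coeffQ (J : Ideal (Poly K n)) {I : Ideal (Poly K n)} (hI : IsGradedIdeal I) (d : Fin n →₀ ℕ) :
    SubQuot J I →ₗ[K] K :=
  (Submodule.liftQ ((Submodule.submoduleOf I J).restrictScalars K)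
    ((if monomial d 1 ∈ I then 0 else lcoeff K d) ∘ₗ (Submodule.subtype J).restrictScalars K)
    (by
      rintro ⟨f, hf⟩ hfI
      change f ∈ I at hfI
      change (if monomial d 1 ∈ I then 0 else lcoeff K d : Poly K n →ₗ[K] K) f = 0
      split_ifs with h
      · rfl
      -- Well-definedness: a graded ideal contains every monomial occurring in its elements, so when
      -- `x^d ∉ I` the coefficient of `x^d` vanishes on `I`.
      · by_contra h0
        exact h (isGradedIdeal_iff.1 hI f hfI d h0))) ∘ₗ
    (Submodule.Quotient.restrictScalarsEquiv K (Submodule.submoduleOf I J)).symm.toLinearMap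

theorem coeffQ_mk_of_notMem {I J : Ideal (Poly K n)} (hI : IsGradedIdeal I) {d : Fin n →₀ ℕ}
    (hd : monomial d 1 ∉ I) {f : Poly K n} (hf : f ∈ J) :
    coeffQ J hI d (SubQuot.mk I f hf) = coeff d f := by
  classical
  change (if monomial d 1 ∈ I then 0 else lcoeff K d : Poly K n →ₗ[K] K) f = _
  rw [if_neg hd]
  rfl

theorem coeffQ_of_mem {I J : Ideal (Poly K n)} (hI : IsGradedIdeal I) {d : Fin n →₀ ℕ}
    (hd : monomial d 1 ∈ I) (m : SubQuot J I) : coeffQ J hI d m = 0 := by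
  obtain ⟨f, hf, rfl⟩ := m.exists_mk
  classical
  change (if monomial d 1 ∈ I then 0 else lcoeff K d : Poly K n →ₗ[K] K) f = _
  rw [if_pos hd]
  rfl

/-- The component consists of classes of scalar multiples of `x^d`, so a single coefficient
determines an element. -/
theorem coeffQ_injOn {I J : Ideal (Poly K n)} (hI : IsGradedIdeal I) {d : Fin n →₀ ℕ}
    {m : SubQuot J I} (hm : m ∈ subQuotGrading J I (toVec d)) (h : coeffQ J hI d m = 0) : m = 0 := by
  obtain ⟨c, hc, rfl⟩ := mem_subQuotGrading_toVec.1 hm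
  rw [SubQuot.mk_eq_zero]
  by_cases hd : monomial d 1 ∈ I
  · exact monomial_mem hd c
  · rw [coeffQ_mk_of_notMem hI hd, coeff_monomial, if_pos rfl] at h
    simp [h]

theorem coeffQ_eq_zero_of_ne {I J : Ideal (Poly K n)} (hI : IsGradedIdeal I) {d : Fin n →₀ ℕ}
    {a : Fin n → ℤ} (ha : a ≠ toVec d) {m : SubQuot J I} (hm : m ∈ subQuotGrading J I a) :
    coeffQ J hI d m = 0 := by
  by_cases hd : monomial d 1 ∈ I
  · exact coeffQ_of_mem hI hd m
  · obtain ⟨f, h, hf, rfl⟩ := mem_subQuotGrading.1 hm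
    rw [coeffQ_mk_of_notMem hI hd]
    by_contra h0
    exact ha (mem_polyGrading.1 h d h0).symm

theorem coeffQ_ne_zero {I J : Ideal (Poly K n)} (hI : IsGradedIdeal I) (hJ : IsGradedIdeal J)
    {d : Fin n →₀ ℕ} {m : SubQuot J I} (h : coeffQ J hI d m ≠ 0) :
    monomial d 1 ∈ J ∧ monomial d 1 ∉ I := by
  have hd : monomial d 1 ∉ I := fun hd => h (coeffQ_of_mem hI hd m)
  obtain ⟨f, hf, rfl⟩ := m.exists_mk
  rw [coeffQ_mk_of_notMem hI hd] at h
  exact ⟨isGradedIdeal_iff.1 hJ f hf d h, hd⟩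

theorem coeffQ_X_smul {I J : Ideal (Poly K n)} (hI : IsGradedIdeal I) {d : Fin n →₀ ℕ} {i : Fin n}
    (hd : monomial (Finsupp.single i 1 + d) 1 ∉ I) (m : SubQuot J I) :
    coeffQ J hI (Finsupp.single i 1 + d) ((X i : Poly K n) • m) = coeffQ J hI d m := by
  have hd' : monomial d 1 ∉ I := fun h => hd (monomial_mem_of_le le_add_self h)
  obtain ⟨f, hf, rfl⟩ := m.exists_mk
  rw [SubQuot.smul_mk, coeffQ_mk_of_notMem hI hd, coeffQ_mk_of_notMem hI hd', coeff_X_mul]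

theorem X_smul_mem_subQuotGrading {I J : Ideal (Poly K n)} (i : Fin n) {a : Fin n → ℤ}
    {m : SubQuot J I} (hm : m ∈ subQuotGrading J I a) :
    (X i : Poly K n) • m ∈ subQuotGrading J I (a + eps i) := by
  by_cases ha : 0 ≤ a
  · obtain ⟨d, rfl⟩ := exists_toVec_eq ha
    obtain ⟨c, hc, rfl⟩ := mem_subQuotGrading_toVec.1 hm
    rw [SubQuot.smul_mk, ← toVec_single, ← toVec_add, mem_subQuotGrading]
    refine ⟨_, ?_, J.mul_mem_left _ hc, rfl⟩
    rw [X, monomial_mul, add_comm]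
    exact monomial_mem_polyGrading _ _
  · rw [subQuotGrading_eq_bot_of_not_nonneg J I ha, Submodule.mem_bot] at hm
    rw [hm, smul_zero]
    exact Submodule.zero_mem _

theorem iSup_subQuotGrading {I J : Ideal (Poly K n)} (hJ : IsGradedIdeal J) :
    iSup (subQuotGrading J I) = ⊤ := by
  rw [eq_top_iff]
  rintro m -
  obtain ⟨f, hf, rfl⟩ := m.exists_mk
  have hmon : ∀ d ∈ f.support, monomial d (coeff d f) ∈ J := fun d hd =>
    monomial_mem (isGradedIdeal_iff.1 hJ f hf d (mem_support_iff.1 hd)) _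
  have key : SubQuot.mk I f hf =
      ∑ d ∈ f.support.attach, SubQuot.mk I (monomial d.1 (coeff d.1 f)) (hmon d.1 d.2) := by
    have : (⟨f, hf⟩ : J) = ∑ d ∈ f.support.attach, ⟨monomial d.1 (coeff d.1 f), hmon d.1 d.2⟩ := by
      refine Subtype.ext ?_
      rw [AddSubmonoidClass.coe_finsetSum, Finset.sum_attach f.support fun d => monomial d (coeff d f)]
      exact f.as_sum
    have h2 := congrArg (Submodule.mkQ (Submodule.submoduleOf I J)) this
    rw [map_sum] at h2
    exact h2
  rw [key]
  exact Submodule.sum_mem _ fun d _ => Submodule.mem_iSup_of_mem (toVec d.1)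
    (mem_subQuotGrading_toVec.2 ⟨_, _, rfl⟩)

theorem isInternal_subQuotGrading {I J : Ideal (Poly K n)} (hI : IsGradedIdeal I)
    (hJ : IsGradedIdeal J) : DirectSum.IsInternal (subQuotGrading J I) := by
  rw [DirectSum.isInternal_submodule_iff_iSupIndep_and_iSup_eq_top]
  refine ⟨fun a => ?_, iSup_subQuotGrading hJ⟩
  by_cases ha : 0 ≤ a
  · obtain ⟨d, rfl⟩ := exists_toVec_eq ha
    rw [Submodule.disjoint_def]
    intro m hm hm'
    refine coeffQ_injOn hI hm ?_
    -- Independence: the functional `coeffQ` at `d` kills all other components but is injective on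
    -- this one.
    have hle : (⨆ b, ⨆ (_ : b ≠ toVec d), subQuotGrading J I b) ≤ LinearMap.ker (coeffQ J hI d) :=
      iSup₂_le fun b hb m hm => coeffQ_eq_zero_of_ne hI hb hm
    exact hle hm'
  · rw [subQuotGrading_eq_bot_of_not_nonneg J I ha]
    exact disjoint_bot_left

theorem IsSquarefreeMonomialIdeal.single_add_mem_iff {I : Ideal (Poly K n)}
    (hI : IsSquarefreeMonomialIdeal I) {d : Fin n →₀ ℕ} {i : Fin n} (hi : d i ≠ 0) :
    monomial (Finsupp.single i 1 + d) 1 ∈ I ↔ monomial d 1 ∈ I := by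
  rw [hI.monomial_mem_iff, hI.monomial_mem_iff]
  have hs : (Finsupp.single i 1 + d).support = d.support := by
    ext j
    by_cases hj : j = i
    · subst hj
      simp [hi]
    · simp [hj]
  rw [hs]

theorem isSquarefreeModule_subQuot {I J : Ideal (Poly K n)} (hI : IsSquarefreeMonomialIdeal I)
    (hJ : IsSquarefreeMonomialIdeal J) : IsSquarefreeModule (subQuotGrading J I) where
  finite := inferInstance
  internal := isInternal_subQuotGrading hI.isGradedIdeal hJ.isGradedIdeal
  nonneg _ ha := subQuotGrading_eq_bot_of_not_nonneg J I ha
  smul_mem i _ _ hm := X_smul_mem_subQuotGrading i hm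
  bijOn i a ha hai := by
    obtain ⟨d, rfl⟩ := exists_toVec_eq ha
    have hdi : d i ≠ 0 := fun h => hai (by simp [toVec, h])
    refine ⟨fun m hm => X_smul_mem_subQuotGrading i hm, fun m hm m' hm' h => ?_, fun m hm => ?_⟩
    -- Injectivity uses that `I` is squarefree; surjectivity, in the next bullet, uses that `J` is.
    · rw [← sub_eq_zero]
      refine coeffQ_injOn hI.isGradedIdeal (Submodule.sub_mem _ hm hm') ?_
      by_cases hd : monomial d 1 ∈ I
      · exact coeffQ_of_mem _ hd _
      · rw [← coeffQ_X_smul _ (mt (hI.single_add_mem_iff hdi).1 hd), smul_sub]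
        dsimp only at h
        rw [h, sub_self, map_zero]
    · rw [SetLike.mem_coe, ← toVec_single, ← toVec_add, add_comm] at hm
      obtain ⟨c, hc, rfl⟩ := mem_subQuotGrading_toVec.1 hm
      have hc' : monomial d c ∈ J := by
        by_cases h0 : c = 0
        · simp [h0]
        · exact monomial_mem ((hJ.single_add_mem_iff hdi).1 (monomial_one_mem h0 hc)) c
      refine ⟨SubQuot.mk I _ hc', mem_subQuotGrading_toVec.2 ⟨c, hc', rfl⟩, ?_⟩
      dsimp only
      rw [SubQuot.smul_mk, SubQuot.mk_eq_mk, X, monomial_mul, one_mul, sub_self]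
      exact I.zero_mem

/-! ### The Alexander dual of `J/I` -/

theorem monomial_ind_mem_dualIdeal {I : Ideal (Poly K n)} {F : Finset (Fin n)} :
    monomial (ind F) 1 ∈ dualIdeal I ↔ monomial (ind Fᶜ) 1 ∉ I := by
  rw [← sqMonomial_eq, ← sqMonomial_eq, sqMonomial_mem_dualIdeal]

theorem isGradedIdeal_dualIdeal (I : Ideal (Poly K n)) : IsGradedIdeal (dualIdeal I) :=
  (isSquarefreeMonomialIdeal_dualIdeal I).isGradedIdeal

/-- The pairing of `(Ĩ/J̃)_F` with `(J/I)_{[n] ∖ F}` given by multiplying coefficients. -/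
def dualPairing {I : Ideal (Poly K n)} (J : Ideal (Poly K n)) (hI : IsGradedIdeal I)
    (F : Finset (Fin n)) : subQuotGrading (dualIdeal I) (dualIdeal J) (vec F) →ₗ[K]
      Module.Dual K (subQuotGrading J I (vec Fᶜ)) :=
  LinearMap.smulRight (coeffQ (dualIdeal I) (isGradedIdeal_dualIdeal J) (ind F) ∘ₗ Submodule.subtype _)
    (coeffQ J hI (ind Fᶜ) ∘ₗ Submodule.subtype _)

theorem dualPairing_apply {I J : Ideal (Poly K n)} (hI : IsGradedIdeal I) (F : Finset (Fin n))
    (m' : subQuotGrading (dualIdeal I) (dualIdeal J) (vec F)) (m : subQuotGrading J I (vec Fᶜ)) :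
    dualPairing J hI F m' m =
      coeffQ (dualIdeal I) (isGradedIdeal_dualIdeal J) (ind F) m'.1 * coeffQ J hI (ind Fᶜ) m.1 := rfl

/-- Both components have dimension at most one, and they are nonzero simultaneously: `x_F ∈ Ĩ ∖ J̃`
iff `x_{F^c} ∈ J ∖ I`. -/
theorem dualPairing_bijective {I J : Ideal (Poly K n)} (hI : IsGradedIdeal I)
    (F : Finset (Fin n)) : Function.Bijective (dualPairing J hI F) := by
  constructor
  · rw [← LinearMap.ker_eq_bot, LinearMap.ker_eq_bot']
    intro m' h
    by_contra h0
    have hc : coeffQ (dualIdeal I) (isGradedIdeal_dualIdeal J) (ind F) m'.1 ≠ 0 := fun hc =>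
      h0 (Subtype.ext (coeffQ_injOn _ (by rw [toVec_ind]; exact m'.2) hc))
    obtain ⟨hdI, hdJ⟩ := coeffQ_ne_zero _ (isGradedIdeal_dualIdeal I) hc
    rw [monomial_ind_mem_dualIdeal] at hdI hdJ
    rw [not_not] at hdJ
    -- Evaluating the zero functional at the class of `x_{F^c}` returns the coefficient of `m'`.
    have := LinearMap.congr_fun h ⟨SubQuot.mk I _ hdJ, by
      rw [← toVec_ind]; exact mem_subQuotGrading_toVec.2 ⟨1, hdJ, rfl⟩⟩
    rw [dualPairing_apply, coeffQ_mk_of_notMem hI hdI, coeff_monomial, if_pos rfl, mul_one] at this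
    exact hc this
  · intro φ
    by_cases hd : monomial (ind Fᶜ) 1 ∈ J ∧ monomial (ind Fᶜ) 1 ∉ I
    · obtain ⟨hdJ, hdI⟩ := hd
      have hI' := monomial_ind_mem_dualIdeal.2 hdI
      have hJ' : monomial (ind F) 1 ∉ dualIdeal J := fun h => monomial_ind_mem_dualIdeal.1 h hdJ
      let v : subQuotGrading J I (vec Fᶜ) := ⟨SubQuot.mk I _ hdJ, by
        rw [← toVec_ind]; exact mem_subQuotGrading_toVec.2 ⟨1, hdJ, rfl⟩⟩
      have hv : coeffQ J hI (ind Fᶜ) v.1 = 1 := by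
        rw [coeffQ_mk_of_notMem hI hdI, coeff_monomial, if_pos rfl]
      refine ⟨⟨SubQuot.mk _ _ (monomial_mem hI' (φ v)), by
        rw [← toVec_ind]; exact mem_subQuotGrading_toVec.2 ⟨_, _, rfl⟩⟩, ?_⟩
      ext m
      rw [dualPairing_apply, coeffQ_mk_of_notMem _ hJ', coeff_monomial, if_pos rfl]
      have hm : m = coeffQ J hI (ind Fᶜ) m.1 • v := by
        rw [← sub_eq_zero]
        refine Subtype.ext (coeffQ_injOn hI (d := ind Fᶜ) (by rw [toVec_ind]; exact Subtype.prop _) ?_)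
        rw [Submodule.coe_sub, Submodule.coe_smul, map_sub, map_smul, hv, smul_eq_mul, mul_one,
          sub_self]
      conv_rhs => rw [hm, map_smul, smul_eq_mul, mul_comm]
    · refine ⟨0, ?_⟩
      ext m
      have hbot : subQuotGrading J I (toVec (ind Fᶜ)) = ⊥ :=
        not_not.1 (mt subQuotGrading_toVec_ne_bot.1 hd)
      rw [toVec_ind] at hbot
      have : m = 0 := Subtype.ext ((Submodule.mem_bot K).1 (hbot.le m.2))
      rw [this, map_zero, map_zero]

theorem isAlexanderDual_subQuot {I J : Ideal (Poly K n)} (hI : IsSquarefreeMonomialIdeal I)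
    (hJ : IsSquarefreeMonomialIdeal J) :
    IsAlexanderDual (subQuotGrading J I) (subQuotGrading (dualIdeal I) (dualIdeal J)) := by
  refine ⟨isSquarefreeModule_subQuot hI hJ,
    isSquarefreeModule_subQuot (isSquarefreeMonomialIdeal_dualIdeal J)
      (isSquarefreeMonomialIdeal_dualIdeal I),
    fun F => LinearEquiv.ofBijective _ (dualPairing_bijective hI.isGradedIdeal F),
    fun F i hi m' p' m p hp' hp => ?_⟩
  rw [LinearEquiv.ofBijective_apply, LinearEquiv.ofBijective_apply, dualPairing_apply,
    dualPairing_apply, hp', hp, ind_insert hi]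
  have hic : i ∉ (insert i F)ᶜ := by simp
  have hFc : ind Fᶜ = Finsupp.single i 1 + ind (insert i F)ᶜ := by
    rw [← ind_insert hic]
    congr 1
    ext j
    by_cases hj : j = i <;> simp [hj, hi]
  -- Multiplication by `x_i` preserves coefficients unless the target monomial lies in the smaller
  -- ideal. If it does on the dual side, then `x_{(F ∪ i)^c} ∉ J`, so `m` has coefficient zero and
  -- both sides vanish.
  by_cases h1 : monomial (ind (insert i F)) 1 ∈ dualIdeal J
  · have h2 := monomial_ind_mem_dualIdeal.1 h1
    have h3 : coeffQ J hI.isGradedIdeal (ind (insert i F)ᶜ) m.1 = 0 := by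
      by_contra h
      exact h2 (coeffQ_ne_zero _ hJ.isGradedIdeal h).1
    rw [h3, mul_zero]
    by_cases h4 : monomial (ind Fᶜ) 1 ∈ I
    · rw [coeffQ_of_mem _ h4, mul_zero]
    · rw [hFc] at h4 ⊢
      rw [coeffQ_X_smul _ h4, h3, mul_zero]
  · rw [ind_insert hi] at h1
    rw [coeffQ_X_smul _ h1]
    -- Symmetrically, `x_{F^c} ∈ I` means `x_F ∉ Ĩ`, which kills the coefficient of `m'`.
    by_cases h4 : monomial (ind Fᶜ) 1 ∈ I
    · have h5 : coeffQ (dualIdeal I) (isGradedIdeal_dualIdeal J) (ind F) m'.1 = 0 := by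
        by_contra h
        exact monomial_ind_mem_dualIdeal.1
          (coeffQ_ne_zero _ (isGradedIdeal_dualIdeal I) h).1 h4
      rw [h5, zero_mul, zero_mul]
    · rw [hFc] at h4 ⊢
      rw [coeffQ_X_smul _ h4]

/-! ### Factors isomorphic to `S/P_F(-G)` -/

/-- The exponents `d` with `(S/P_F(-G))_d ≠ 0`. -/
def InCell (F G : Finset (Fin n)) (d : Fin n →₀ ℕ) : Prop :=
  ind G ≤ d ∧ ∀ i ∈ F, d i = ind G i

theorem mem_monomialPrime {F : Finset (Fin n)} {f : Poly K n} :
    f ∈ monomialPrime K F ↔ ∀ e, coeff e f ≠ 0 → ∃ i ∈ F, e i ≠ 0 := by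
  rw [monomialPrime, mem_ideal_span_X_image]
  simp only [mem_support_iff, Finset.mem_coe]

theorem monomial_mem_monomialPrime {F : Finset (Fin n)} {e : Fin n →₀ ℕ} :
    (monomial e 1 : Poly K n) ∈ monomialPrime K F ↔ ∃ i ∈ F, e i ≠ 0 := by
  classical
  rw [mem_monomialPrime]
  constructor
  · intro h
    exact h e (by simp)
  · intro h e' he'
    rw [coeff_monomial] at he'
    split_ifs at he' with hee
    · exact hee ▸ h
    · exact absurd rfl he'

theorem inCell_add_iff {F G : Finset (Fin n)} {e : Fin n →₀ ℕ} :
    InCell F G (e + ind G) ↔ ∀ i ∈ F, e i = 0 := by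
  simp [InCell]

theorem mem_quotGrading {P : Ideal (Poly K n)} {a : Fin n → ℤ} {m : Poly K n ⧸ P} :
    m ∈ quotGrading P a ↔ ∃ f, f ∈ polyGrading K n a ∧ Ideal.Quotient.mk P f = m := Iff.rfl

theorem quotGrading_ne_bot {P : Ideal (Poly K n)} {a : Fin n → ℤ} :
    quotGrading P a ≠ ⊥ ↔ ∃ e, toVec e = a ∧ (monomial e 1 : Poly K n) ∉ P := by
  rw [Submodule.ne_bot_iff]
  constructor
  · rintro ⟨m, hm, h0⟩
    obtain ⟨f, hf, rfl⟩ := mem_quotGrading.1 hm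
    by_contra! h
    refine h0 (Ideal.Quotient.eq_zero_iff_mem.2 (mem_of_forall_monomial fun d hd => ?_))
    exact h d (mem_polyGrading.1 hf d hd)
  · rintro ⟨e, rfl, he⟩
    exact ⟨_, mem_quotGrading.2 ⟨_, monomial_mem_polyGrading e 1, rfl⟩,
      fun h => he (Ideal.Quotient.eq_zero_iff_mem.1 h)⟩

theorem shiftNeg_quotGrading_ne_bot {F G : Finset (Fin n)} {d : Fin n →₀ ℕ} :
    shiftNeg (quotGrading (monomialPrime K F)) (vec G) (toVec d) ≠ ⊥ ↔ InCell F G d := by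
  rw [shiftNeg, quotGrading_ne_bot]
  simp only [monomial_mem_monomialPrime, not_exists, not_and, not_not]
  constructor
  · rintro ⟨e, he, h⟩
    have : d = e + ind G := toVec_injective (by rw [toVec_add, he, toVec_ind, sub_add_cancel])
    rwa [this, inCell_add_iff]
  · intro h
    obtain ⟨e, rfl⟩ : ∃ e, d = e + ind G := ⟨d - ind G, (tsub_add_cancel_of_le h.1).symm⟩
    exact ⟨e, by rw [toVec_add, toVec_ind, add_sub_cancel_right], inCell_add_iff.1 h⟩

theorem GradedIso.eq_bot_iff {M N : Type*} [AddCommGroup M] [Module K M] [Module (Poly K n) M]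
    [AddCommGroup N] [Module K N] [Module (Poly K n) N]
    {gr : (Fin n → ℤ) → Submodule K M} {gr' : (Fin n → ℤ) → Submodule K N}
    (h : GradedIso gr gr') (a : Fin n → ℤ) : gr a = ⊥ ↔ gr' a = ⊥ := by
  obtain ⟨e, he⟩ := h
  rw [Submodule.eq_bot_iff, Submodule.eq_bot_iff, ← e.toEquiv.forall_congr_right]
  refine forall_congr' fun m => ?_
  rw [he]
  exact imp_congr_right fun _ => e.map_eq_zero_iff.symm

/-- The class of `x_G` generates `J/I` and has annihilator `P_F`, so multiplication `f ↦ f x_G`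
induces the isomorphism. -/
theorem gradedIso_of_inCell {I J : Ideal (Poly K n)} (hI : IsGradedIdeal I) (hJ : IsGradedIdeal J)
    {F G : Finset (Fin n)}
    (h : ∀ d, (monomial d (1 : K) ∈ J ∧ monomial d (1 : K) ∉ I) ↔ InCell F G d) :
    GradedIso (subQuotGrading J I) (shiftNeg (quotGrading (monomialPrime K F)) (vec G)) := by
  have hG : monomial (ind G) (1 : K) ∈ J := ((h _).2 ⟨le_rfl, fun _ _ => rfl⟩).1
  let φ : Poly K n →ₗ[Poly K n] SubQuot J I :=
    LinearMap.toSpanSingleton (Poly K n) (SubQuot J I) (SubQuot.mk I _ hG)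
  have hφ : ∀ f, φ f = SubQuot.mk I (f * monomial (ind G) 1) (J.mul_mem_left f hG) := fun f => rfl
  have hker : LinearMap.ker φ = monomialPrime K F := by
    ext f
    rw [LinearMap.mem_ker, hφ, SubQuot.mk_eq_zero, mem_monomialPrime]
    have hcell : ∀ e : Fin n →₀ ℕ, monomial (e + ind G) (1 : K) ∈ I ↔ ∃ i ∈ F, e i ≠ 0 := by
      intro e
      have h1 := h (e + ind G)
      rw [inCell_add_iff, and_iff_right (monomial_mem_of_le le_add_self hG)] at h1
      rw [← not_iff_not, h1]
      push Not
      rfl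
    constructor
    · intro hf e he
      rw [← hcell]
      refine isGradedIdeal_iff.1 hI _ hf _ ?_
      rwa [coeff_mul_monomial, mul_one]
    · intro hf
      rw [f.as_sum, Finset.sum_mul]
      refine I.sum_mem fun e he => ?_
      rw [monomial_mul]
      exact monomial_mem ((hcell e).2 (hf e (mem_support_iff.1 he))) _
  -- Lifts are chosen homogeneous of the shifted degree, which serves both surjectivity and the
  -- preservation of degrees.
  have hmon : ∀ (d : Fin n →₀ ℕ) (c : K) (hc : monomial d c ∈ J),
      ∃ f ∈ polyGrading K n (toVec d - vec G), φ f = SubQuot.mk I _ hc := by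
    intro d c hc
    by_cases hd : monomial d c ∈ I
    · exact ⟨0, Submodule.zero_mem _, by rw [map_zero, eq_comm, SubQuot.mk_eq_zero]; exact hd⟩
    · have hc0 : c ≠ 0 := by
        rintro rfl
        simp at hd
      have hcell := (h d).1 ⟨monomial_one_mem hc0 hc, fun h => hd (monomial_mem h c)⟩
      obtain ⟨e, rfl⟩ : ∃ e, d = e + ind G := ⟨d - ind G, (tsub_add_cancel_of_le hcell.1).symm⟩
      refine ⟨monomial e c, ?_, ?_⟩
      · rw [toVec_add, toVec_ind, add_sub_cancel_right]
        exact monomial_mem_polyGrading e c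
      · rw [hφ, SubQuot.mk_eq_mk, monomial_mul, mul_one, sub_self]
        exact I.zero_mem
  have hsurj : Function.Surjective φ := by
    rw [← LinearMap.range_eq_top, eq_top_iff]
    rintro m -
    have hm : m ∈ iSup (subQuotGrading J I) := iSup_subQuotGrading hJ ▸ Submodule.mem_top
    refine (iSup_le fun a m hm => ?_ :
      iSup (subQuotGrading J I) ≤ (LinearMap.range φ).restrictScalars K) hm
    by_cases ha : 0 ≤ a
    · obtain ⟨d, rfl⟩ := exists_toVec_eq ha
      obtain ⟨c, hc, rfl⟩ := mem_subQuotGrading_toVec.1 hm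
      obtain ⟨f, -, hf⟩ := hmon d c hc
      exact ⟨f, hf⟩
    · rw [subQuotGrading_eq_bot_of_not_nonneg J I ha, Submodule.mem_bot] at hm
      rw [hm]
      exact Submodule.zero_mem _
  let e : (Poly K n ⧸ monomialPrime K F) ≃ₗ[Poly K n] SubQuot J I :=
    (Submodule.quotEquivOfEq _ _ hker.symm).trans (φ.quotKerEquivOfSurjective hsurj)
  have he : ∀ f, e (Ideal.Quotient.mk _ f) = φ f := fun f => rfl
  refine ⟨e.symm, fun a m => ?_⟩
  rw [shiftNeg, mem_quotGrading]
  constructor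
  · intro hm
    by_cases ha : 0 ≤ a
    · obtain ⟨d, rfl⟩ := exists_toVec_eq ha
      obtain ⟨c, hc, rfl⟩ := mem_subQuotGrading_toVec.1 hm
      obtain ⟨f, hf, hfm⟩ := hmon d c hc
      exact ⟨f, hf, by rw [LinearEquiv.eq_symm_apply, he, hfm]⟩
    · rw [subQuotGrading_eq_bot_of_not_nonneg J I ha, Submodule.mem_bot] at hm
      exact ⟨0, Submodule.zero_mem _, by rw [hm, map_zero, map_zero]⟩
  · rintro ⟨f, hf, hfm⟩
    rw [LinearEquiv.eq_symm_apply, he, hφ] at hfm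
    rw [← hfm, mem_subQuotGrading]
    refine ⟨_, ?_, _, rfl⟩
    rw [mem_polyGrading] at hf ⊢
    intro d hd
    rw [coeff_mul_monomial'] at hd
    split_ifs at hd with hle
    · obtain ⟨e, rfl⟩ : ∃ e, d = e + ind G := ⟨d - ind G, (tsub_add_cancel_of_le hle).symm⟩
      rw [add_tsub_cancel_right, mul_one] at hd
      rw [toVec_add, toVec_ind, hf e hd, sub_add_cancel]
    · exact absurd rfl hd

theorem gradedIso_iff {I J : Ideal (Poly K n)} (hI : IsGradedIdeal I) (hJ : IsGradedIdeal J)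
    {F G : Finset (Fin n)} :
    GradedIso (subQuotGrading J I) (shiftNeg (quotGrading (monomialPrime K F)) (vec G)) ↔
      ∀ d, (monomial d (1 : K) ∈ J ∧ monomial d (1 : K) ∉ I) ↔ InCell F G d := by
  refine ⟨fun h d => ?_, gradedIso_of_inCell hI hJ⟩
  rw [← subQuotGrading_toVec_ne_bot, ← shiftNeg_quotGrading_ne_bot (K := K)]
  exact not_congr (h.eq_bot_iff _)

/-! ### Duality of the factors -/

/-- The exponent `d_i + 1` is at least 2, whereas the cell fixes exponents in `F` to be 0 or 1;
hence `i ∉ F`, and lowering this exponent stays in the cell. -/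
theorem inCell_of_single_add {F G : Finset (Fin n)} {d : Fin n →₀ ℕ} {i : Fin n} (hi : d i ≠ 0)
    (h : InCell F G (Finsupp.single i 1 + d)) : InCell F G d := by
  have hiF : i ∉ F := fun hiF => by
    have := h.2 i hiF
    rw [Finsupp.add_apply, Finsupp.single_eq_same, ind_apply] at this
    split_ifs at this <;> omega
  refine ⟨ind_le_iff.2 fun j hj => ?_, fun j hj => ?_⟩
  · by_cases hji : j = i
    · rw [hji]
      exact Finsupp.mem_support_iff.2 hi
    · simpa [hji] using ind_le_iff.1 h.1 hj
  · have hji : j ≠ i := fun hji => hiF (hji ▸ hj)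
    simpa [hji] using h.2 j hj

theorem inCell_iff_of_disjoint {F G : Finset (Fin n)} (hFG : Disjoint F G) {d : Fin n →₀ ℕ} :
    InCell F G d ↔ G ⊆ d.support ∧ Disjoint F d.support := by
  rw [InCell, ind_le_iff, Finset.disjoint_left]
  refine and_congr_right fun _ => forall₂_congr fun i hi => ?_
  rw [ind_apply, if_neg (Finset.disjoint_left.1 hFG hi), Finsupp.notMem_support_iff]

/-- For `i ∈ F ∩ G`, squarefreeness would put `x_i x_G` in `J ∖ I` along with `x_G`, but the cell
fixes the exponent of `x_i` at 1. -/
theorem disjoint_of_inCell {I J : Ideal (Poly K n)} (hI : IsSquarefreeMonomialIdeal I)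
    (hJ : IsSquarefreeMonomialIdeal J) {F G : Finset (Fin n)}
    (h : ∀ d, (monomial d (1 : K) ∈ J ∧ monomial d (1 : K) ∉ I) ↔ InCell F G d) :
    Disjoint F G := by
  rw [Finset.disjoint_left]
  intro i hiF hiG
  have hi : ind G i ≠ 0 := by simp [ind_apply, hiG]
  have h1 := (h (ind G)).2 ⟨le_rfl, fun _ _ => rfl⟩
  rw [← hI.single_add_mem_iff hi, ← hJ.single_add_mem_iff hi] at h1
  have := ((h _).1 h1).2 i hiF
  simp at this

theorem gradedIso_dualIdeal {I J : Ideal (Poly K n)} (hI : IsSquarefreeMonomialIdeal I)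
    (hJ : IsSquarefreeMonomialIdeal J) {F G : Finset (Fin n)}
    (h : GradedIso (subQuotGrading J I) (shiftNeg (quotGrading (monomialPrime K F)) (vec G))) :
    GradedIso (subQuotGrading (dualIdeal I) (dualIdeal J))
      (shiftNeg (quotGrading (monomialPrime K G)) (vec F)) := by
  rw [gradedIso_iff hI.isGradedIdeal hJ.isGradedIdeal] at h
  have hFG := disjoint_of_inCell hI hJ h
  rw [gradedIso_iff (isGradedIdeal_dualIdeal J) (isGradedIdeal_dualIdeal I)]
  intro d
  -- The dual condition at `d` is the original one at the complement of its support: `G ⊆ (supp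
  -- d)^c` and `F ∩ (supp d)^c = ∅` are the two cell conditions with `F` and `G` exchanged.
  have h1 := h (ind d.supportᶜ)
  rw [inCell_iff_of_disjoint hFG, support_ind, ← sqMonomial_eq] at h1
  rw [(isSquarefreeMonomialIdeal_dualIdeal _).monomial_mem_iff,
    (isSquarefreeMonomialIdeal_dualIdeal _).monomial_mem_iff, sqMonomial_mem_dualIdeal,
    sqMonomial_mem_dualIdeal, not_not, and_comm, h1, inCell_iff_of_disjoint hFG.symm, and_comm, disjoint_compl_right_iff,
    le_compl_iff_disjoint_right]

/-! ### Prime filtrations -/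

/-- Induction up the chain. If `d_k ≠ 0` and `x_k x^d` lies in the next ideal, it lies either in the
previous one, squarefree by induction, or in the cell of the factor; in both cases `x_k` can be
cancelled. -/
theorem IsPrimeFiltration.isSquarefreeMonomialIdeal {I J : Ideal (Poly K n)}
    (hI : IsSquarefreeMonomialIdeal I) {r : ℕ} {L : Fin (r + 1) → Ideal (Poly K n)}
    {F G : Fin r → Finset (Fin n)} (h : IsPrimeFiltration I J r L F G) (i : Fin (r + 1)) :
    IsSquarefreeMonomialIdeal (L i) := by
  induction i using Fin.induction with
  | zero => exact h.bot ▸ hI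
  | succ i ih =>
    have hcell := (gradedIso_iff (h.graded _) (h.graded _)).1 (h.factor i)
    refine isSquarefreeMonomialIdeal_of_lower (h.graded _) fun d k hk hd => ?_
    by_cases hd' : monomial (Finsupp.single k 1 + d) 1 ∈ L i.castSucc
    · exact h.le i ((ih.single_add_mem_iff hk).1 hd')
    · exact ((hcell d).2 (inCell_of_single_add hk ((hcell _).1 ⟨hd, hd'⟩))).1

/-- Duality reverses inclusions, so the chain is reindexed by `Fin.rev`, which interchanges the
lower and upper ends of each step. -/
theorem IsPrimeFiltration.dual {I J : Ideal (Poly K n)} {r : ℕ}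
    {L : Fin (r + 1) → Ideal (Poly K n)} {F G : Fin r → Finset (Fin n)}
    (hL : ∀ i, IsSquarefreeMonomialIdeal (L i)) (h : IsPrimeFiltration I J r L F G) :
    IsPrimeFiltration (dualIdeal J) (dualIdeal I) r (fun i => dualIdeal (L i.rev))
      (fun i => G i.rev) (fun i => F i.rev) where
  bot := by rw [Fin.rev_zero, h.top]
  top := by rw [Fin.rev_last, h.bot]
  graded _ := isGradedIdeal_dualIdeal _
  le i := by
    rw [Fin.rev_castSucc, Fin.rev_succ]
    exact dualIdeal_anti (h.le _)
  factor i := by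
    rw [Fin.rev_castSucc, Fin.rev_succ]
    exact gradedIso_dualIdeal (hL _) (hL _) (h.factor _)

end SqMod

end

theorem mainTheorem9 {K : Type*} [Field K] {n : ℕ} (I J : Ideal (SqMod.Poly K n))
    (hI : SqMod.IsSquarefreeMonomialIdeal I) (hJ : SqMod.IsSquarefreeMonomialIdeal J)
    (hIJ : I ≤ J) :
    (SqMod.dualIdeal J ≤ SqMod.dualIdeal I ∧
      SqMod.IsAlexanderDual (SqMod.subQuotGrading J I)
        (SqMod.subQuotGrading (SqMod.dualIdeal I) (SqMod.dualIdeal J))) ∧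
    ∀ (r : ℕ) (L : Fin (r + 1) → Ideal (SqMod.Poly K n)) (F G : Fin r → Finset (Fin n)),
      SqMod.IsPrimeFiltration I J r L F G ↔
        (∀ i, SqMod.IsSquarefreeMonomialIdeal (L i)) ∧
          SqMod.IsPrimeFiltration (SqMod.dualIdeal J) (SqMod.dualIdeal I) r
            (fun i => SqMod.dualIdeal (L i.rev)) (fun i => G i.rev) (fun i => F i.rev) := by
  refine ⟨⟨SqMod.dualIdeal_anti hIJ, SqMod.isAlexanderDual_subQuot hI hJ⟩, fun r L F G =>
    ⟨fun h => ?_, fun ⟨hL, h⟩ => ?_⟩⟩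
  · have hL := h.isSquarefreeMonomialIdeal hI
    exact ⟨hL, h.dual hL⟩
  -- Dualizing again reverses the indices back; squarefreeness of each `L i`, part of (b), is what
  -- lets the double dual recover it.
  · have h' := h.dual fun _ => SqMod.isSquarefreeMonomialIdeal_dualIdeal _
    simpa only [SqMod.dualIdeal_dualIdeal hI, SqMod.dualIdeal_dualIdeal hJ,
      SqMod.dualIdeal_dualIdeal (hL _), Fin.rev_rev] using h'
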